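/- Let $k\ge 1$. For $\pi\in S_n$ and $\sigma\in S_k$, let $P_\sigma(\pi)$ be the number of $a_1<\dots<a_k$ in $\{1,\dots,n\}$ such that, for all $i,j$, $\sigma(i)<\sigma(j)$ if and only if $\pi(a_i)<\pi(a_j)$, divided by $\binom nk$. For $n\ge k$, let $\mathbf P_{kn}=(P_\sigma(\pi))_{\sigma\in S_k}\in\mathbb R^{k!}$ be the $k$-profile of a uniformly random $\pi\in S_n$. For $0\le r<k$, let $V_r\subseteq\mathbb R^{k!}$ be the span of all vectors $(R_{ij}(\sigma))_{\sigma\in S_k}$, where $R$ runs over the real matrix forms of the simple representations $\rho^\lambda$ of $S_k$ that correspond to partitions $\lambda\vdash k$ with largest part $\lambda_1=k-r$ (that is, $\rho^\lambda$ is the left action of $S_k$ on $\mathbb R[S_k]\,c_T$, with $c_T$ the Young symmetrizer of a tableau $T$ of shape $\lambda$). Let $\Pi_r:\mathbb R^{k!}\to V_r$ be the orthogonal projection for the standard inner product. **Theorem.** For all integers $0\le r<s<k$, $$E\left[\left(n^{r/2}\,\Pi_r\mathbf P_{kn}\right)\left(n^{s/2}\,\Pi_s\mathbf P_{kn}\right)^T\right]\xrightarrow[n\to\infty]{}\mathbf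 0\quad\text{in }\mathbb R^{k!\times k!},$$ and the normalized components $n^{r/2}\,\Pi_r\mathbf P_{kn}$ and $n^{s/2}\,\Pi_s\mathbf P_{kn}$ are asymptotically uncorrelated: their cross-covariance matrix also tends to $\mathbf 0$ as $n\to\infty$. Moreover, for all $\mathbf u\in V_r$ and $\mathbf v\in V_s$, $$E\left[\langle\mathbf u,\mathbf P_{kn}\rangle\,\langle\mathbf v,\mathbf P_{kn}\rangle\right]=O\left(n^{-s}\right)\quad\text{as }n\to\infty .$$ -/

import Mathlib

open Filter Topology Asymptotics
open scoped Nat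

noncomputable section

namespace PatternProfile

/-! ### Patterns and profiles of permutations -/

/-- The Euclidean space `ℝ^{k!}`, with coordinates indexed by `S_k`. -/
abbrev ProfileSpace (k : ℕ) : Type := EuclideanSpace ℝ (Equiv.Perm (Fin k))

/-- The number of occurrences of the pattern `σ ∈ S_k` in `π ∈ S_n`: the number of choices of
positions `a 0 < a 1 < ⋯ < a (k-1)` at which the values of `π` are ordered as those of `σ`. -/
def patternCount {k n : ℕ} (σ : Equiv.Perm (Fin k)) (π : Equiv.Perm (Fin n)) : ℕ :=
  Nat.card {a : Fin k ↪o Fin n // ∀ i j : Fin k, σ i < σ j ↔ π (a i) < π (a j)}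

/-- The density of the pattern `σ ∈ S_k` in `π ∈ S_n` (meaningful for `k ≤ n`). -/
def density {k n : ℕ} (σ : Equiv.Perm (Fin k)) (π : Equiv.Perm (Fin n)) : ℝ :=
  (patternCount σ π : ℝ) / (n.choose k : ℝ)

/-- The `k`-profile of `π`: the vector of all `k`-pattern densities. -/
def profile (k : ℕ) {n : ℕ} (π : Equiv.Perm (Fin n)) : ProfileSpace k :=
  WithLp.toLp 2 fun σ => density σ π

/-- The expectation of a vector-valued random variable on `S_n` with its uniform distribution. -/
def expectation {n : ℕ} {E : Type*} [AddCommGroup E] [Module ℝ E]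
    (X : Equiv.Perm (Fin n) → E) : E :=
  ((n ! : ℝ))⁻¹ • ∑ π : Equiv.Perm (Fin n), X π

/-! ### The simple representations of the symmetric group

Partitions of `k` are Young diagrams `μ` with `k` cells, whose largest part is the length
`μ.rowLen 0` of the first row. A tableau of shape `μ` is a bijection `T` that gives
the cell `(row, column)` of every number. -/

/-- The group algebra `ℝ S_k`. -/
abbrev GroupAlgebra (k : ℕ) : Type := MonoidAlgebra ℝ (Equiv.Perm (Fin k))

/-- `a_T`: the sum of all permutations that preserve every row of the tableau `T`. -/
def rowSum {k : ℕ} {μ : YoungDiagram} (T : Fin k ≃ μ.cells) : GroupAlgebra k :=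
  ∑ σ : Equiv.Perm (Fin k) with ∀ i, (T (σ i)).1.1 = (T i).1.1, MonoidAlgebra.of ℝ _ σ

/-- `b_T`: the signed sum of all permutations that preserve every column of the tableau `T`. -/
def columnSum {k : ℕ} {μ : YoungDiagram} (T : Fin k ≃ μ.cells) : GroupAlgebra k :=
  ∑ σ : Equiv.Perm (Fin k) with ∀ i, (T (σ i)).1.2 = (T i).1.2,
    ((Equiv.Perm.sign σ : ℤ) : ℝ) • MonoidAlgebra.of ℝ _ σ

/-- The Young symmetrizer `c_T = a_T b_T`. -/
def youngSymmetrizer {k : ℕ} {μ : YoungDiagram} (T : Fin k ≃ μ.cells) : GroupAlgebra k :=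
  rowSum T * columnSum T

/-- The subspace `A c_T = {x c_T | x ∈ A}` of `A = ℝ S_k`. -/
def simpleSpace {k : ℕ} {μ : YoungDiagram} (T : Fin k ≃ μ.cells) :
    Submodule ℝ (GroupAlgebra k) :=
  LinearMap.range (LinearMap.mulRight ℝ (youngSymmetrizer T))

theorem mul_mem_simpleSpace {k : ℕ} {μ : YoungDiagram} (T : Fin k ≃ μ.cells)
    (y : GroupAlgebra k) : ∀ x ∈ simpleSpace T, LinearMap.mulLeft ℝ y x ∈ simpleSpace T := by
  rintro _ ⟨x, rfl⟩
  exact ⟨y * x, by simp [mul_assoc]⟩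

/-- The simple representation of `S_k` attached to the shape of `T`: the action of `S_k` on
`A c_T` by multiplication on the left. -/
def simpleRep {k : ℕ} {μ : YoungDiagram} (T : Fin k ≃ μ.cells) :
    Representation ℝ (Equiv.Perm (Fin k)) (simpleSpace T) where
  toFun σ := (LinearMap.mulLeft ℝ (MonoidAlgebra.of ℝ _ σ)).restrict (mul_mem_simpleSpace T _)
  map_one' := by
    ext1 x
    apply Subtype.ext
    simp [LinearMap.restrict_apply, ← MonoidAlgebra.one_def]
  map_mul' σ τ := by
    ext1 x
    apply Subtype.ext
    simp only [map_mul, LinearMap.restrict_apply, LinearMap.mulLeft_apply, Module.End.mul_apply,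
      mul_assoc]

/-- The matrix element `(R i j (σ))_σ`, where `R` is the representation `simpleRep T` written
as matrices in the basis `b`. -/
def matrixElement {k : ℕ} {μ : YoungDiagram} (T : Fin k ≃ μ.cells) {d : ℕ}
    (b : Module.Basis (Fin d) ℝ (simpleSpace T)) (i j : Fin d) : ProfileSpace k :=
  WithLp.toLp 2 fun σ => LinearMap.toMatrix b b (simpleRep T σ) i j

/-- The subspace `V_r` of `ℝ^{k!}`: the span of all matrix elements of the simple representations
of `S_k` attached to the partitions of `k` with largest part `k - r`. -/
def V (k r : ℕ) : Submodule ℝ (ProfileSpace k) :=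
  Submodule.span ℝ {v | ∃ (μ : YoungDiagram) (T : Fin k ≃ μ.cells) (d : ℕ)
    (b : Module.Basis (Fin d) ℝ (simpleSpace T)) (i j : Fin d),
    μ.rowLen 0 + r = k ∧ v = matrixElement T b i j}

/-- The normalized order `r` component `n^{r/2} Π_r P_k(π)` of the `k`-profile of `π ∈ S_n`, where
`Π_r` is the orthogonal projection onto `V_r`. -/
def component (k r : ℕ) {n : ℕ} (π : Equiv.Perm (Fin n)) : ProfileSpace k :=
  ((n : ℝ) ^ ((r : ℝ) / 2)) • (V k r).starProjection (profile k π)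

/-- The cross second-moment matrix `E[X Yᵀ]` of two random vectors on `S_n`. -/
def crossMoment {k n : ℕ} (X Y : Equiv.Perm (Fin n) → ProfileSpace k) :
    Matrix (Equiv.Perm (Fin k)) (Equiv.Perm (Fin k)) ℝ :=
  expectation fun π => Matrix.vecMulVec (X π).ofLp (Y π).ofLp

/-- The cross-covariance matrix `E[(X - E[X]) (Y - E[Y])ᵀ]` of two random vectors on `S_n`. -/
def crossCovariance {k n : ℕ} (X Y : Equiv.Perm (Fin n) → ProfileSpace k) :
    Matrix (Equiv.Perm (Fin k)) (Equiv.Perm (Fin k)) ℝ :=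
  crossMoment (fun π => X π - expectation X) (fun π => Y π - expectation Y)

end PatternProfile

end

namespace PatternProfile

/-! Vectors of `V k s` vanish when summed over any coset τS_D with |D| > k - s. Indeed, a diagram
with first row k - s has k - s columns, so in any tableau two elements of D share a column. The
symmetrizer of D absorbs their transposition, while the column antisymmetrizer changes sign under
it, so the product is its own negative (`sum_permsOn_of_mem_V`).

Expand the second moment over pairs (a, b) of position sets. If a and b share fewer than s
positions, shuffling π at the positions of b outside a keeps the pattern at a and moves the pattern
at b through such a coset, so the pair contributes 0 (`sum_pattern_mul_pattern_eq_zero`). Only a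
fraction O(n^{-s}) of the pairs share at least s positions (`card_overlap_le`), which gives the
bound O(n^{-s}). The normalization n^{(r+s)/2} leaves n^{-(s-r)/2} → 0. Pairing with the all-ones
vector, whose product with a profile is 1, bounds the means, and hence the covariance. -/

/-- The permutations that fix every point outside `D`. -/
def permsOn {α : Type*} [Fintype α] [DecidableEq α] (D : Finset α) : Finset (Equiv.Perm α) :=
  {σ | ∀ i ∉ D, σ i = i}

section permsOn

variable {α : Type*} [Fintype α] [DecidableEq α] {D : Finset α}

theorem mem_permsOn {σ : Equiv.Perm α} : σ ∈ permsOn D ↔ ∀ i ∉ D, σ i = i := by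
  simp [permsOn]

theorem swap_mem_permsOn {i j : α} (hi : i ∈ D) (hj : j ∈ D) : Equiv.swap i j ∈ permsOn D := by
  rw [mem_permsOn]
  intro x hx
  exact Equiv.swap_apply_of_ne_of_ne (by rintro rfl; exact hx hi) (by rintro rfl; exact hx hj)

theorem one_mem_permsOn : (1 : Equiv.Perm α) ∈ permsOn D := by
  simp [mem_permsOn]

theorem sum_permsOn_mul_swap {M : Type*} [AddCommMonoid M] {i j : α} (hi : i ∈ D) (hj : j ∈ D)
    (f : Equiv.Perm α → M) :
    ∑ σ ∈ permsOn D, f (σ * Equiv.swap i j) = ∑ σ ∈ permsOn D, f σ := by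
  have ht := mem_permsOn.1 (swap_mem_permsOn hi hj)
  refine Finset.sum_equiv (Equiv.mulRight (Equiv.swap i j)) (fun σ => ?_) (fun σ _ => rfl)
  simp only [mem_permsOn, Equiv.coe_mulRight, Equiv.Perm.mul_apply]
  refine forall₂_congr fun x hx => ?_
  rw [ht x hx]

end permsOn

/-! ### Symmetrizers of large sets annihilate the simple representations -/

section youngSymmetrizer

variable {k : ℕ} {μ : YoungDiagram} (T : Fin k ≃ μ.cells)

theorem of_swap_mul_columnSum {i j : Fin k} (hij : i ≠ j) (h : (T i).1.2 = (T j).1.2) :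
    MonoidAlgebra.of ℝ _ (Equiv.swap i j) * columnSum T = -columnSum T := by
  have hcol : ∀ x, (T (Equiv.swap i j x)).1.2 = (T x).1.2 := by
    intro x
    rcases eq_or_ne x i with rfl | hi
    · simp [h]
    rcases eq_or_ne x j with rfl | hj
    · simp [h]
    rw [Equiv.swap_apply_of_ne_of_ne hi hj]
  rw [columnSum, Finset.mul_sum, ← Finset.sum_neg_distrib]
  refine Finset.sum_equiv (Equiv.mulLeft (Equiv.swap i j)) (fun σ => ?_) (fun σ _ => ?_)
  · simp [hcol]
  · simp [Equiv.Perm.sign_swap hij]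

theorem sum_permsOn_mul_columnSum {D : Finset (Fin k)} (hD : μ.rowLen 0 < D.card)
    (w : GroupAlgebra k) :
    (∑ σ ∈ permsOn D, MonoidAlgebra.of ℝ _ σ) * w * columnSum T = 0 := by
  induction w using MonoidAlgebra.induction_on with
  | of τ =>
    obtain ⟨i, hi, j, hj, hij, hcol⟩ : ∃ i ∈ D, ∃ j ∈ D, i ≠ j ∧
        (T (τ⁻¹ i)).1.2 = (T (τ⁻¹ j)).1.2 := by
      refine Finset.exists_ne_map_eq_of_card_lt_of_maps_to (t := Finset.range (μ.rowLen 0))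
        (by simpa using hD) (fun i _ => ?_)
      -- Sliding the cell up to row 0 of the diagram shows that its column index is below `μ.rowLen
      -- 0`.
      have hmem : ((T (τ⁻¹ i)).1.1, (T (τ⁻¹ i)).1.2) ∈ μ := (T (τ⁻¹ i)).2
      exact Finset.mem_coe.2 (Finset.mem_range.2
        (YoungDiagram.mem_iff_lt_rowLen.1 (μ.up_left_mem (Nat.zero_le _) le_rfl hmem)))
    have hne : τ⁻¹ i ≠ τ⁻¹ j := fun h => hij (τ⁻¹.injective h)
    have hconj : Equiv.swap i j * τ = τ * Equiv.swap (τ⁻¹ i) (τ⁻¹ j) := by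
      rw [Equiv.mul_swap_eq_swap_mul]; simp
    have key : (∑ σ ∈ permsOn D, MonoidAlgebra.of ℝ _ σ) * MonoidAlgebra.of ℝ _ τ * columnSum T
        = -((∑ σ ∈ permsOn D, MonoidAlgebra.of ℝ _ σ) * MonoidAlgebra.of ℝ _ τ * columnSum T) := by
      conv_lhs =>
        -- The transposition is absorbed on the left, conjugated past τ, and meets the column sum,
        -- which it negates.
        rw [← sum_permsOn_mul_swap hi hj]
        simp only [map_mul]
        rw [← Finset.sum_mul, mul_assoc _ _ (MonoidAlgebra.of ℝ _ τ), ← map_mul, hconj, map_mul,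
          ← mul_assoc, mul_assoc _ _ (columnSum T), of_swap_mul_columnSum T hne hcol, mul_neg]
    have h2 := add_eq_zero_iff_eq_neg.2 key
    rw [← two_smul ℝ] at h2
    exact (smul_eq_zero.1 h2).resolve_left two_ne_zero
  | add f g hf hg => rw [mul_add, add_mul, hf, hg, add_zero]
  | smul r f hf => rw [mul_smul_comm, smul_mul_assoc, hf, smul_zero]

theorem sum_permsOn_simpleRep {D : Finset (Fin k)} (hD : μ.rowLen 0 < D.card)
    (τ : Equiv.Perm (Fin k)) : ∑ σ ∈ permsOn D, simpleRep T (τ * σ) = 0 := by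
  ext1 ⟨y, z, hz⟩
  apply Subtype.ext
  have h := sum_permsOn_mul_columnSum T hD (z * rowSum T)
  have h' : ∑ σ ∈ permsOn D, MonoidAlgebra.of ℝ _ (τ * σ) * y = 0 := by
    simp only [map_mul]
    rw [← Finset.sum_mul, ← Finset.mul_sum, ← hz, LinearMap.mulRight_apply, youngSymmetrizer,
      mul_assoc, ← mul_assoc z, ← mul_assoc (∑ σ ∈ permsOn D, _), h, mul_zero]
  simpa [simpleRep, LinearMap.sum_apply, LinearMap.restrict_apply] using h'

end youngSymmetrizer

theorem sum_permsOn_of_mem_V {k s : ℕ} {v : ProfileSpace k} (hv : v ∈ V k s)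
    {D : Finset (Fin k)} (hD : k < D.card + s) (τ : Equiv.Perm (Fin k)) :
    ∑ σ ∈ permsOn D, v (τ * σ) = 0 := by
  induction hv using Submodule.span_induction with
  | mem v h =>
    obtain ⟨μ, T, d, b, i, j, hμ, rfl⟩ := h
    have h := congrArg (fun f => LinearMap.toMatrix b b f i j)
      (sum_permsOn_simpleRep T (D := D) (by omega) τ)
    simpa [matrixElement, Matrix.sum_apply] using h
  | zero => simp
  | add x y _ _ hx hy => simp [Finset.sum_add_distrib, hx, hy]
  | smul c x _ hx => simp [← Finset.mul_sum, hx]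

/-! ### The pattern of an injective sequence -/

section pattern

variable {k n : ℕ}

/-- The permutation whose values are ordered as those of `f`. -/
def pattern (f : Fin k → Fin n) : Equiv.Perm (Fin k) := (Tuple.sort f)⁻¹

/-- `Tuple.sort f` lists the indices by increasing value, so its inverse sends each index to its
rank. -/
theorem pattern_lt_iff {f : Fin k → Fin n} (hf : Function.Injective f) (i j : Fin k) :
    pattern f i < pattern f j ↔ f i < f j := by
  have hmono : StrictMono (f ∘ Tuple.sort f) :=
    (Tuple.monotone_sort f).strictMono_of_injective (hf.comp (Tuple.sort f).injective)
  have h := hmono.lt_iff_lt (a := pattern f i) (b := pattern f j)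
  simpa [pattern] using h.symm

theorem perm_eq_of_lt_iff {σ τ : Equiv.Perm (Fin k)} (h : ∀ i j, σ i < σ j ↔ τ i < τ j) :
    σ = τ := by
  -- The only order automorphism of `Fin k` is the identity.
  have hmono : StrictMono (σ * τ⁻¹) := fun i j hij => (h _ _).2 (by simpa using hij)
  have h1 := congrArg DFunLike.coe (Subsingleton.elim
    (hmono.orderIsoOfSurjective _ (σ * τ⁻¹).surjective) (OrderIso.refl (Fin k)))
  refine mul_inv_eq_one.1 (Equiv.ext fun i => ?_)
  simpa using congrFun h1 i

theorem eq_pattern_iff {f : Fin k → Fin n} (hf : Function.Injective f) {σ : Equiv.Perm (Fin k)} :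
    (∀ i j, σ i < σ j ↔ f i < f j) ↔ σ = pattern f := by
  refine ⟨fun h => perm_eq_of_lt_iff fun i j => ?_, ?_⟩
  · rw [h, pattern_lt_iff hf]
  · rintro rfl
    exact pattern_lt_iff hf

/-- Shuffling positions is right multiplication, so it moves patterns along the left cosets of
`sum_permsOn_of_mem_V`. -/
theorem pattern_comp_perm {f : Fin k → Fin n} (hf : Function.Injective f)
    (σ : Equiv.Perm (Fin k)) : pattern (f ∘ σ) = pattern f * σ := by
  refine ((eq_pattern_iff (hf.comp σ.injective)).1 fun i j => ?_).symm
  simp [pattern_lt_iff hf]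

theorem inner_profile (v : ProfileSpace k) (π : Equiv.Perm (Fin n)) :
    inner ℝ v (profile k π) =
      (n.choose k : ℝ)⁻¹ * ∑ a : Fin k ↪o Fin n, v (pattern (π ∘ a)) := by
  classical
  have hcount (σ : Equiv.Perm (Fin k)) : (patternCount σ π : ℝ) =
      ∑ a : Fin k ↪o Fin n, if σ = pattern (π ∘ a) then 1 else 0 := by
    rw [patternCount, Nat.card_eq_fintype_card, Fintype.card_subtype, Finset.sum_boole]
    congr 2
    ext a
    simp only [Finset.mem_filter, Finset.mem_univ, true_and]
    exact eq_pattern_iff (π.injective.comp a.injective)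
  have h : ∑ σ, (patternCount σ π : ℝ) * v σ =
      ∑ a : Fin k ↪o Fin n, v (pattern (π ∘ a)) := by
    simp_rw [hcount, Finset.sum_mul]
    rw [Finset.sum_comm]
    simp
  rw [← h, Finset.mul_sum, PiLp.inner_apply]
  refine Finset.sum_congr rfl fun σ _ => ?_
  simp only [profile, density, RCLike.inner_apply, conj_trivial]
  ring

end pattern

/-! ### The second moments -/

section moments

variable {k n : ℕ}

theorem sum_pattern_mul_pattern_eq_zero {s : ℕ} (u : ProfileSpace k) {v : ProfileSpace k}
    (hv : v ∈ V k s) (a b : Fin k ↪o Fin n)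
    (hab : (Finset.univ.filter fun j => b j ∈ Set.range a).card < s) :
    ∑ π : Equiv.Perm (Fin n), u (pattern (π ∘ a)) * v (pattern (π ∘ b)) = 0 := by
  classical
  set D : Finset (Fin k) := Finset.univ.filter fun j => b j ∉ Set.range a with hDdef
  have hD : k < D.card + s := by
    have h := Finset.card_filter_add_card_filter_not (s := (Finset.univ : Finset (Fin k)))
      (fun j => b j ∈ Set.range a)
    rw [Finset.card_univ, Fintype.card_fin] at h
    have : D.card = (Finset.univ.filter fun j => ¬ b j ∈ Set.range a).card := rfl
    omega
  have htrans : ∀ σ ∈ permsOn D,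
      ∑ π : Equiv.Perm (Fin n), u (pattern (π ∘ a)) * v (pattern (π ∘ b)) =
      ∑ π : Equiv.Perm (Fin n), u (pattern (π ∘ a)) * v (pattern (π ∘ b) * σ) := by
    intro σ hσ
    -- Reindex by π ↦ πσ', with σ' the transport of σ along b; it moves only positions b(j) with j ∈
    -- D, none of which lies in the range of a.
    rw [← Equiv.sum_comp (Equiv.mulRight (σ.viaFintypeEmbedding b.toEmbedding))]
    have hb : (σ.viaFintypeEmbedding b.toEmbedding) ∘ b = b ∘ σ := by
      ext1 j
      exact σ.viaFintypeEmbedding_apply_image b.toEmbedding j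
    have ha : (σ.viaFintypeEmbedding b.toEmbedding) ∘ a = a := by
      ext1 i
      by_cases hi : a i ∈ Set.range b
      · obtain ⟨j, hj⟩ := hi
        have hjD : j ∉ D := by simp [hDdef, hj]
        have := congrFun hb j
        simpa [mem_permsOn.1 hσ j hjD, hj] using this
      · exact σ.viaFintypeEmbedding_apply_notMem_range b.toEmbedding hi
    refine Finset.sum_congr rfl fun π _ => ?_
    simp only [Equiv.coe_mulRight, Equiv.Perm.coe_mul, Function.comp_assoc, ha, hb]
    rw [← Function.comp_assoc, pattern_comp_perm (π.injective.comp b.injective)]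
  -- Summing over σ multiplies the left side by |S_D| ≠ 0 and turns the right side into coset sums,
  -- which vanish.
  have hsum := Finset.sum_congr rfl htrans
  rw [Finset.sum_const, Finset.sum_comm] at hsum
  simp_rw [← Finset.mul_sum, sum_permsOn_of_mem_V hv hD] at hsum
  simp only [mul_zero, Finset.sum_const_zero, smul_eq_zero, Finset.card_eq_zero] at hsum
  exact hsum.resolve_left (Finset.ne_empty_of_mem one_mem_permsOn)

theorem card_overlap_le (s : ℕ) (a : Fin k ↪o Fin n) :
    (Finset.univ.filter fun b : Fin k ↪o Fin n =>
      s ≤ (Finset.univ.filter fun j => b j ∈ Set.range a).card).card ≤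
      k.choose s * (k ^ s * n ^ (k - s)) := by
  classical
  -- Union bound: `F S` holds all maps sending S into the range of a, with no order condition, so
  -- its size is a product.
  let F : Finset (Fin k) → Finset (Fin k → Fin n) := fun S =>
    Fintype.piFinset fun j => if j ∈ S then Finset.univ.image a else Finset.univ
  have hF : ∀ S ∈ Finset.powersetCard s (Finset.univ : Finset (Fin k)),
      (F S).card ≤ k ^ s * n ^ (k - s) := by
    intro S hS
    have hS' := (Finset.mem_powersetCard.1 hS).2
    have h1 : (F S).card = ∏ j : Fin k, if j ∈ S then k else n := by
      rw [Fintype.card_piFinset]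
      refine Finset.prod_congr rfl fun j _ => ?_
      split_ifs
      · rw [Finset.card_image_of_injective _ a.injective]; simp
      · simp
    rw [h1, Finset.prod_ite, Finset.prod_const, Finset.prod_const, Finset.filter_mem_eq_inter,
      Finset.univ_inter, ← Finset.compl_filter, Finset.filter_mem_eq_inter, Finset.univ_inter,
      Finset.card_compl, hS', Fintype.card_fin]
  calc _ ≤ ((Finset.powersetCard s (Finset.univ : Finset (Fin k))).biUnion F).card := by
        refine Finset.card_le_card_of_injOn (fun b => (b : Fin k → Fin n)) ?_
          (DFunLike.coe_injective.injOn)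
        intro b hb
        obtain ⟨S, hS, hcard⟩ := Finset.exists_subset_card_eq (Finset.mem_filter.1 hb).2
        refine Finset.mem_coe.2 (Finset.mem_biUnion.2 ⟨S,
          Finset.mem_powersetCard.2 ⟨Finset.subset_univ _, hcard⟩, ?_⟩)
        refine Fintype.mem_piFinset.2 fun j => ?_
        split_ifs with hj
        · simpa using (Finset.mem_filter.1 (hS hj)).2
        · exact Finset.mem_univ _
    _ ≤ ∑ S ∈ Finset.powersetCard s (Finset.univ : Finset (Fin k)), (F S).card :=
        Finset.card_biUnion_le
    _ ≤ ∑ S ∈ Finset.powersetCard s (Finset.univ : Finset (Fin k)), k ^ s * n ^ (k - s) :=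
        Finset.sum_le_sum hF
    _ = _ := by simp

theorem card_orderEmbedding_fin : Fintype.card (Fin k ↪o Fin n) = n.choose k := by
  rw [← Nat.card_eq_fintype_card, Nat.card_congr Set.powersetCard.ofFinEmbEquiv,
    Set.powersetCard.card, Nat.card_eq_fintype_card, Fintype.card_fin]

end moments

/-! ### Decay of second and first moments -/

section asymptotics

variable {k : ℕ}

theorem expectation_inner_mul_inner {n : ℕ} (u v : ProfileSpace k) :
    (expectation fun π : Equiv.Perm (Fin n) =>
        inner ℝ u (profile k π) * inner ℝ v (profile k π)) =
      (n ! : ℝ)⁻¹ * ((n.choose k : ℝ)⁻¹ * ((n.choose k : ℝ)⁻¹ *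
        ∑ a : Fin k ↪o Fin n, ∑ b : Fin k ↪o Fin n,
          ∑ π : Equiv.Perm (Fin n), u (pattern (π ∘ a)) * v (pattern (π ∘ b)))) := by
  have h : ∑ a : Fin k ↪o Fin n, ∑ b : Fin k ↪o Fin n,
      ∑ π : Equiv.Perm (Fin n), u (pattern (π ∘ a)) * v (pattern (π ∘ b)) =
      ∑ π : Equiv.Perm (Fin n), (∑ a : Fin k ↪o Fin n, u (pattern (π ∘ a))) *
        ∑ b : Fin k ↪o Fin n, v (pattern (π ∘ b)) := by
    simp_rw [Finset.sum_mul_sum]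
    refine (Finset.sum_congr rfl fun a _ => ?_).trans Finset.sum_comm
    exact Finset.sum_comm
  rw [h, expectation, smul_eq_mul]
  congr 1
  rw [Finset.mul_sum, Finset.mul_sum]
  refine Finset.sum_congr rfl fun π _ => ?_
  rw [inner_profile, inner_profile]
  ring

theorem abs_expectation_inner_mul_inner_le {n s : ℕ} (u : ProfileSpace k) {v : ProfileSpace k}
    (hv : v ∈ V k s) (hn : k ≤ n) :
    |expectation fun π : Equiv.Perm (Fin n) =>
        inner ℝ u (profile k π) * inner ℝ v (profile k π)| ≤
      (‖u‖ * ‖v‖) * (k.choose s * (k ^ s * n ^ (k - s))) / n.choose k := by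
  classical
  have hchoose : (0 : ℝ) < n.choose k := by exact_mod_cast Nat.choose_pos hn
  have hfac : (0 : ℝ) < n ! := by exact_mod_cast n.factorial_pos
  have hpair (a b : Fin k ↪o Fin n) :
      |∑ π : Equiv.Perm (Fin n), u (pattern (π ∘ a)) * v (pattern (π ∘ b))| ≤
        if s ≤ (Finset.univ.filter fun j => b j ∈ Set.range a).card
        then n ! * (‖u‖ * ‖v‖) else 0 := by
    split_ifs with h
    · calc _ ≤ ∑ π : Equiv.Perm (Fin n), |u (pattern (π ∘ a)) * v (pattern (π ∘ b))| :=
            Finset.abs_sum_le_sum_abs _ _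
        _ ≤ ∑ π : Equiv.Perm (Fin n), ‖u‖ * ‖v‖ := by
            refine Finset.sum_le_sum fun π _ => ?_
            rw [abs_mul]
            exact mul_le_mul (PiLp.norm_apply_le u _) (PiLp.norm_apply_le v _) (abs_nonneg _)
              (norm_nonneg _)
        _ = _ := by simp [Fintype.card_perm]
    · rw [sum_pattern_mul_pattern_eq_zero u hv a b (not_le.1 h), abs_zero]
  have hsum : |∑ a : Fin k ↪o Fin n, ∑ b : Fin k ↪o Fin n,
      ∑ π : Equiv.Perm (Fin n), u (pattern (π ∘ a)) * v (pattern (π ∘ b))| ≤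
      n.choose k * ((k.choose s * (k ^ s * n ^ (k - s))) * (n ! * (‖u‖ * ‖v‖))) := by
    calc _ ≤ ∑ a : Fin k ↪o Fin n, ∑ b : Fin k ↪o Fin n,
          |∑ π : Equiv.Perm (Fin n), u (pattern (π ∘ a)) * v (pattern (π ∘ b))| :=
          (Finset.abs_sum_le_sum_abs _ _).trans
            (Finset.sum_le_sum fun a _ => Finset.abs_sum_le_sum_abs _ _)
      _ ≤ ∑ a : Fin k ↪o Fin n, ((k.choose s * (k ^ s * n ^ (k - s))) * (n ! * (‖u‖ * ‖v‖))) := by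
          refine Finset.sum_le_sum fun a _ => (Finset.sum_le_sum fun b _ => hpair a b).trans ?_
          rw [← Finset.sum_filter, Finset.sum_const, nsmul_eq_mul]
          refine mul_le_mul_of_nonneg_right ?_ (by positivity)
          exact_mod_cast card_overlap_le s a
      _ = _ := by
          rw [Finset.sum_const, Finset.card_univ, card_orderEmbedding_fin, nsmul_eq_mul]
  rw [expectation_inner_mul_inner, abs_mul, abs_mul, abs_mul, abs_inv, abs_inv, abs_of_pos hchoose,
    abs_of_pos hfac]
  calc _ ≤ (n ! : ℝ)⁻¹ * ((n.choose k : ℝ)⁻¹ * ((n.choose k : ℝ)⁻¹ *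
        (n.choose k * ((k.choose s * (k ^ s * n ^ (k - s))) * (n ! * (‖u‖ * ‖v‖)))))) := by
        gcongr
    _ = _ := by field_simp

theorem pow_le_mul_choose {n : ℕ} (hn : 2 * k ≤ n) :
    (n : ℝ) ^ k ≤ 2 ^ k * k ! * n.choose k := by
  have h1 := Nat.pow_le_choose (α := ℝ) k n
  rw [div_le_iff₀ (by positivity)] at h1
  -- This is where n ≥ 2k enters; it is the source of the factor 2^k.
  have h2 : (n : ℝ) ≤ 2 * (n + 1 - k : ℕ) := by
    have : n ≤ 2 * (n + 1 - k) := by omega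
    exact_mod_cast this
  calc (n : ℝ) ^ k ≤ (2 * (n + 1 - k : ℕ)) ^ k := by gcongr
    _ = 2 ^ k * ((n + 1 - k : ℕ) : ℝ) ^ k := mul_pow _ _ _
    _ ≤ 2 ^ k * (n.choose k * k !) := by gcongr
    _ = _ := by ring

theorem isBigO_expectation_inner_mul_inner {s : ℕ} (hs : s ≤ k) (u : ProfileSpace k)
    {v : ProfileSpace k} (hv : v ∈ V k s) :
    (fun n : ℕ => expectation fun π : Equiv.Perm (Fin n) =>
      inner ℝ u (profile k π) * inner ℝ v (profile k π)) =O[atTop] fun n : ℕ => ((n : ℝ) ^ s)⁻¹ := by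
  refine IsBigO.of_bound ((‖u‖ * ‖v‖) * (k.choose s * k ^ s) * (2 ^ k * k !)) ?_
  filter_upwards [eventually_ge_atTop (2 * k), eventually_gt_atTop 0] with n hn hn0
  have hchoose : (0 : ℝ) < n.choose k := by exact_mod_cast Nat.choose_pos (by omega : k ≤ n)
  have hn' : (0 : ℝ) < n := by exact_mod_cast hn0
  rw [Real.norm_eq_abs, Real.norm_of_nonneg (by positivity)]
  refine (abs_expectation_inner_mul_inner_le u hv (by omega)).trans ?_
  rw [div_le_iff₀ hchoose]
  have hpow : (n : ℝ) ^ (k - s) = n ^ k * ((n : ℝ) ^ s)⁻¹ := pow_sub₀ _ hn'.ne' hs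
  calc (‖u‖ * ‖v‖) * (k.choose s * (k ^ s * n ^ (k - s)))
      = (‖u‖ * ‖v‖) * (k.choose s * k ^ s) * ((n : ℝ) ^ s)⁻¹ * n ^ k := by rw [hpow]; ring
    _ ≤ (‖u‖ * ‖v‖) * (k.choose s * k ^ s) * ((n : ℝ) ^ s)⁻¹ * (2 ^ k * k ! * n.choose k) := by
        gcongr
        exact pow_le_mul_choose hn
    _ = _ := by ring

theorem inner_one_profile {n : ℕ} (hn : k ≤ n) (π : Equiv.Perm (Fin n)) :
    inner ℝ (WithLp.toLp 2 (fun _ => 1) : ProfileSpace k) (profile k π) = 1 := by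
  have hchoose : (n.choose k : ℝ) ≠ 0 := by exact_mod_cast (Nat.choose_pos hn).ne'
  rw [inner_profile]
  simp [card_orderEmbedding_fin, hchoose]

theorem isBigO_expectation_inner {s : ℕ} (hs : s ≤ k) {v : ProfileSpace k} (hv : v ∈ V k s) :
    (fun n : ℕ => expectation fun π : Equiv.Perm (Fin n) => inner ℝ v (profile k π))
      =O[atTop] fun n : ℕ => ((n : ℝ) ^ s)⁻¹ := by
  refine (isBigO_expectation_inner_mul_inner hs (WithLp.toLp 2 fun _ => 1) hv).congr' ?_ .rfl
  filter_upwards [eventually_ge_atTop k] with n hn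
  simp_rw [inner_one_profile hn, one_mul]

/-- The projection is self-adjoint, so each coordinate is a pairing of the profile with a fixed
vector of `V k r`. -/
theorem component_apply {n : ℕ} (r : ℕ) (π : Equiv.Perm (Fin n)) (σ : Equiv.Perm (Fin k)) :
    component k r π σ = (n : ℝ) ^ ((r : ℝ) / 2) *
      inner ℝ ((V k r).starProjection (EuclideanSpace.single σ 1)) (profile k π) := by
  rw [Submodule.inner_starProjection_left_eq_right, EuclideanSpace.inner_single_left]
  simp [component]

end asymptotics

section moments

variable {k n : ℕ} (X Y : Equiv.Perm (Fin n) → ProfileSpace k)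

theorem expectation_apply (σ : Equiv.Perm (Fin k)) :
    expectation X σ = expectation fun π => X π σ := by
  simp [expectation]

theorem expectation_const_mul (c : ℝ) (f : Equiv.Perm (Fin n) → ℝ) :
    (expectation fun π => c * f π) = c * expectation f := by
  simp only [expectation, smul_eq_mul, ← Finset.mul_sum]
  ring

theorem crossMoment_apply (σ τ : Equiv.Perm (Fin k)) :
    crossMoment X Y σ τ = expectation fun π => X π σ * Y π τ := by
  simp [crossMoment, expectation, Matrix.sum_apply, Matrix.vecMulVec_apply]

theorem crossCovariance_apply (σ τ : Equiv.Perm (Fin k)) :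
    crossCovariance X Y σ τ = crossMoment X Y σ τ -
      (expectation fun π => X π σ) * expectation fun π => Y π τ := by
  have hn : (n ! : ℝ) ≠ 0 := by exact_mod_cast n.factorial_ne_zero
  rw [crossCovariance, crossMoment_apply, crossMoment_apply]
  simp only [PiLp.sub_apply, expectation_apply]
  simp only [expectation, smul_eq_mul, sub_mul, mul_sub, Finset.sum_sub_distrib,
    ← Finset.sum_mul, ← Finset.mul_sum, Finset.sum_const, Finset.card_univ, Fintype.card_perm,
    Fintype.card_fin, nsmul_eq_mul]
  field_simp
  ring

end moments

/-! ### Limits of the normalized cross moments -/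

section limits

variable {k : ℕ}

theorem rpow_half_mul_inv_pow {x : ℝ} (hx : 0 < x) (r s : ℕ) :
    x ^ ((r : ℝ) / 2) * x ^ ((s : ℝ) / 2) * (x ^ s)⁻¹ = x ^ (-(((s : ℝ) - r) / 2)) := by
  rw [← Real.rpow_natCast, ← Real.rpow_neg hx.le, ← Real.rpow_add hx, ← Real.rpow_add hx]
  congr 1
  ring

theorem tendsto_zero_of_isBigO_inv_pow {f : ℕ → ℝ} {r s : ℕ} (hrs : r < s)
    (hf : f =O[atTop] fun n : ℕ => ((n : ℝ) ^ s)⁻¹) :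
    Tendsto (fun n : ℕ => (n : ℝ) ^ ((r : ℝ) / 2) * (n : ℝ) ^ ((s : ℝ) / 2) * f n)
      atTop (𝓝 0) := by
  have hpos : (0 : ℝ) < ((s : ℝ) - r) / 2 := by
    have : (r : ℝ) < s := by exact_mod_cast hrs
    linarith
  refine ((isBigO_refl (fun n : ℕ => (n : ℝ) ^ ((r : ℝ) / 2) * (n : ℝ) ^ ((s : ℝ) / 2))
    atTop).mul hf).trans_tendsto ?_
  refine ((tendsto_rpow_neg_atTop hpos).comp tendsto_natCast_atTop_atTop).congr' ?_
  filter_upwards [eventually_gt_atTop 0] with n hn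
  exact (rpow_half_mul_inv_pow (by exact_mod_cast hn) r s).symm

theorem tendsto_crossMoment_component {r s : ℕ} (hrs : r < s) (hsk : s < k) :
    Tendsto (fun n : ℕ => crossMoment (fun π : Equiv.Perm (Fin n) => component k r π)
      (fun π : Equiv.Perm (Fin n) => component k s π)) atTop (𝓝 0) := by
  refine tendsto_pi_nhds.2 fun σ => tendsto_pi_nhds.2 fun τ => ?_
  refine (tendsto_zero_of_isBigO_inv_pow hrs (isBigO_expectation_inner_mul_inner hsk.le
    ((V k r).starProjection (EuclideanSpace.single σ 1))
    ((V k s).starProjection_apply_mem (EuclideanSpace.single τ 1)))).congr fun n => ?_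
  rw [crossMoment_apply, ← expectation_const_mul]
  simp_rw [component_apply]
  congr 1
  ext1 π
  ring

theorem tendsto_expectation_mul_expectation {r s : ℕ} (hrs : r < s) (hsk : s < k)
    (σ τ : Equiv.Perm (Fin k)) :
    Tendsto (fun n : ℕ => (expectation fun π : Equiv.Perm (Fin n) => component k r π σ) *
      expectation fun π : Equiv.Perm (Fin n) => component k s π τ) atTop (𝓝 0) := by
  have hr := isBigO_expectation_inner (hrs.trans hsk).le
    ((V k r).starProjection_apply_mem (EuclideanSpace.single σ 1))
  -- Boundedness of the order r mean suffices: the order s mean already supplies n^{-s}.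
  have hr' : (fun n : ℕ => ((n : ℝ) ^ r)⁻¹) =O[atTop] fun _ => (1 : ℝ) := by
    refine IsBigO.of_bound 1 ?_
    filter_upwards [eventually_ge_atTop 1] with n hn
    have : (1 : ℝ) ≤ n := by exact_mod_cast hn
    rw [Real.norm_of_nonneg (by positivity), norm_one, one_mul]
    exact inv_le_one_of_one_le₀ (one_le_pow₀ this)
  have hs := isBigO_expectation_inner hsk.le
    ((V k s).starProjection_apply_mem (EuclideanSpace.single τ 1))
  have h := (hr.trans hr').mul hs
  simp only [one_mul] at h
  refine (tendsto_zero_of_isBigO_inv_pow hrs h).congr fun n => ?_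
  simp_rw [component_apply, expectation_const_mul]
  ring

theorem tendsto_crossCovariance_component {r s : ℕ} (hrs : r < s) (hsk : s < k) :
    Tendsto (fun n : ℕ => crossCovariance (fun π : Equiv.Perm (Fin n) => component k r π)
      (fun π : Equiv.Perm (Fin n) => component k s π)) atTop (𝓝 0) := by
  refine tendsto_pi_nhds.2 fun σ => tendsto_pi_nhds.2 fun τ => ?_
  have h1 := tendsto_pi_nhds.1 (tendsto_pi_nhds.1 (tendsto_crossMoment_component hrs hsk) σ) τ
  have h2 := h1.sub (tendsto_expectation_mul_expectation hrs hsk σ τ)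
  simp only [Matrix.zero_apply, sub_zero] at h2
  simpa only [crossCovariance_apply, Matrix.zero_apply] using h2

end limits
end PatternProfile

theorem theorem2 (k r s : ℕ) (hrs : r < s) (hsk : s < k) :
    Tendsto
      (fun n : ℕ => PatternProfile.crossMoment
        (fun π : Equiv.Perm (Fin n) => PatternProfile.component k r π)
        (fun π : Equiv.Perm (Fin n) => PatternProfile.component k s π))
      atTop (𝓝 (0 : Matrix (Equiv.Perm (Fin k)) (Equiv.Perm (Fin k)) ℝ)) ∧
    Tendsto
      (fun n : ℕ => PatternProfile.crossCovariance
        (fun π : Equiv.Perm (Fin n) => PatternProfile.component k r π)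
        (fun π : Equiv.Perm (Fin n) => PatternProfile.component k s π))
      atTop (𝓝 (0 : Matrix (Equiv.Perm (Fin k)) (Equiv.Perm (Fin k)) ℝ)) ∧
    ∀ u ∈ PatternProfile.V k r, ∀ v ∈ PatternProfile.V k s,
      (fun n : ℕ => PatternProfile.expectation fun π : Equiv.Perm (Fin n) =>
        inner ℝ u (PatternProfile.profile k π) * inner ℝ v (PatternProfile.profile k π))
      =O[atTop] fun n : ℕ => ((n : ℝ) ^ s)⁻¹ :=
  ⟨PatternProfile.tendsto_crossMoment_component hrs hsk,
    PatternProfile.tendsto_crossCovariance_component hrs hsk,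
    fun u _ _ hv => PatternProfile.isBigO_expectation_inner_mul_inner hsk.le u hv⟩
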